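/- **Theorem (Soundness and Completeness of GŁ$_s$).** Let formulas be built from propositional variables $p_0,p_1,p_2,\dots$ and the constant $\bot$ with the binary connective $\Rightarrow$. A sequent $\Gamma\vdash\Delta$ is an ordered pair of finite (possibly empty) multisets of formulas; commas denote multiset sum. The calculus GŁ$_s$ has the axioms $$(ID)\ \ A\vdash A,\qquad (\Lambda)\ \ \vdash\,,\qquad (\bot)\ \ \bot\vdash A,$$ and the rules - $(W)$: from $\Gamma\vdash\Delta$ infer $\Gamma,A\vdash\Delta$; - $(M)$: from $\Gamma_1\vdash\Delta_1$ and $\Gamma_2\vdash\Delta_2$ infer $\Gamma_1,\Gamma_2\vdash\Delta_1,\Delta_2$; - $(C)$: for any integer $n>0$, from $\underbrace{\Gamma,\dots,\Gamma}_{n}\vdash\underbrace{\Delta,\dots,\Delta}_{n}$ infer $\Gamma\vdash\Delta$; - $(\Rightarrow,l)$: from $\Gamma,B,B\Rightarrow A\vdash\Delta,A$ infer $\Gamma,A\Rightarrow B\vdash\Delta$; - $(\Rightarrow,r)$: from $\Gamma\vdash\Delta$ and $\Gamma,A\vdash\Delta,B$ infer $\Gamma\vdash\Delta,A\Rightarrow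 B$. A sequent *succeeds* in GŁ$_s$ if it can be derived from the axioms by finitely many applications of the rules. Let $[-1,0]_{\textrm{Ł}}$ be the MV-algebra on the real interval $[-1,0]$ with $a\oplus b=\min(0,a+b+1)$, $\sim a=-1-a$, $\bot=-1$, in which $\Rightarrow$ is interpreted by $\sim a\oplus b=\min(0,b-a)$. A valuation is a map $v$ from formulas to $[-1,0]$ with $v(\bot)=-1$ and $v(A\Rightarrow B)=\min(0,v(B)-v(A))$. Write $\models^*_{\textrm{Ł}}\Gamma\vdash\Delta$ if $\sum_{A\in\Gamma}v(A)\le\sum_{B\in\Delta}v(B)$ for all valuations $v$ (real sums, counted with multiplicity, the empty sum being $0$). Then, for every sequent $S$, $$S\text{ succeeds in GŁ}_s\iff\ \models^*_{\textrm{Ł}}S.$$ -/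

import Mathlib

namespace Lukasiewicz

/-- Formulas of Łukasiewicz logic over the propositional variables `p₀, p₁, …`,
with primitive connectives `⊥` and `⇒`. -/
inductive Formula : Type
  | var (i : ℕ) : Formula
  | bot : Formula
  | imp (A B : Formula) : Formula

/-- A sequent `Γ ⊢ Δ`: an ordered pair of finite multisets of formulas. -/
structure Sequent : Type where
  left : Multiset Formula
  right : Multiset Formula

/-- The carrier `[-1, 0]` of the MV-algebra `[-1, 0]_Ł`. -/
abbrev Carrier : Type := Set.Icc (-1 : ℝ) 0

namespace Carrier

/-- The constant `⊥ = -1`. -/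
def bot : Carrier := ⟨-1, by norm_num, by norm_num⟩

/-- The operation `a ⊕ b = min (0, a + b + 1)`. -/
noncomputable def oplus (a b : Carrier) : Carrier :=
  ⟨min 0 ((a : ℝ) + b + 1),
    le_min (by norm_num) (by linarith [a.2.1, b.2.1]), min_le_left _ _⟩

/-- The operation `∼a = -1 - a`. -/
def neg (a : Carrier) : Carrier :=
  ⟨-1 - (a : ℝ), by linarith [a.2.2], by linarith [a.2.1]⟩

/-- The implication `∼a ⊕ b`. -/
noncomputable def imp (a b : Carrier) : Carrier := oplus (neg a) b

theorem coe_imp (a b : Carrier) : (imp a b : ℝ) = min 0 ((b : ℝ) - a) := by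
  change min 0 (-1 - (a : ℝ) + b + 1) = _
  congr 1
  ring

end Carrier

/-- A valuation `v : For → [-1, 0]_Ł`: a map commuting with the connectives. -/
structure Valuation : Type where
  val : Formula → Carrier
  map_bot : val Formula.bot = Carrier.bot
  map_imp : ∀ A B : Formula, val (Formula.imp A B) = Carrier.imp (val A) (val B)

/-- `⊨*_Ł Γ ⊢ Δ`: for every valuation `v` in `[-1, 0]_Ł`, the sum of the values `v A`
over `A ∈ Γ` is at most the sum of the values `v B` over `B ∈ Δ`. The sums are sums of
real numbers over multisets, counted with multiplicity. -/
def Sequent.Valid (S : Sequent) : Prop :=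
  ∀ v : Valuation,
    (S.left.map fun A => (v.val A : ℝ)).sum ≤ (S.right.map fun B => (v.val B : ℝ)).sum

/-- `GLs S` says that the sequent `S` succeeds (has a proof) in the unlabelled single
sequent calculus `GŁ_s`. -/
inductive GLs : Sequent → Prop
  /-- `(ID)`: the axiom `A ⊢ A`. -/
  | id (A : Formula) : GLs ⟨{A}, {A}⟩
  /-- `(Λ)`: the empty sequent as an axiom. -/
  | empty : GLs ⟨0, 0⟩
  /-- `(⊥)`: the axiom `⊥ ⊢ A`. -/
  | bot (A : Formula) : GLs ⟨{Formula.bot}, {A}⟩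
  /-- `(W)`: from `Γ ⊢ Δ` infer `Γ, A ⊢ Δ`. -/
  | weak (Γ Δ : Multiset Formula) (A : Formula) :
      GLs ⟨Γ, Δ⟩ → GLs ⟨Γ + {A}, Δ⟩
  /-- `(M)`: from `Γ₁ ⊢ Δ₁` and `Γ₂ ⊢ Δ₂` infer `Γ₁, Γ₂ ⊢ Δ₁, Δ₂`. -/
  | mix (Γ₁ Γ₂ Δ₁ Δ₂ : Multiset Formula) :
      GLs ⟨Γ₁, Δ₁⟩ → GLs ⟨Γ₂, Δ₂⟩ → GLs ⟨Γ₁ + Γ₂, Δ₁ + Δ₂⟩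
  /-- `(C)`: from `Γ, …, Γ ⊢ Δ, …, Δ` (`n > 0` copies each) infer `Γ ⊢ Δ`. -/
  | contr (n : ℕ) (Γ Δ : Multiset Formula) :
      0 < n → GLs ⟨n • Γ, n • Δ⟩ → GLs ⟨Γ, Δ⟩
  /-- `(⇒, l)`: from `Γ, B, B ⇒ A ⊢ Δ, A` infer `Γ, A ⇒ B ⊢ Δ`. -/
  | impL (Γ Δ : Multiset Formula) (A B : Formula) :
      GLs ⟨Γ + {B} + {Formula.imp B A}, Δ + {A}⟩ → GLs ⟨Γ + {Formula.imp A B}, Δ⟩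
  /-- `(⇒, r)`: from `Γ ⊢ Δ` and `Γ, A ⊢ Δ, B` infer `Γ ⊢ Δ, A ⇒ B`. -/
  | impR (Γ Δ : Multiset Formula) (A B : Formula) :
      GLs ⟨Γ, Δ⟩ → GLs ⟨Γ + {A}, Δ + {B}⟩ → GLs ⟨Γ, Δ + {Formula.imp A B}⟩

end Lukasiewicz

/-! Soundness is an induction on derivations. For completeness, (⇒,r) is semantically invertible, so
the right side may be taken free of implications. Two derived principles then carry the syntax: an
immediate subformula of an implication on the left may be cancelled from both sides (`GLs.cancel`),
and if such a component is itself `C ⇒ D`, one may branch on adding `C ⇒ D` or `D ⇒ C` to the left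
(`GLs.split`). Finitely many branchings fix the order of the subformulas of every implicational
component.

In a decided branch, Farkas' lemma over ℚ replaces proof search. If the inequality of the goal
follows linearly from those of finitely many short derivable sequents, clearing denominators turns
the combination into uses of (M), (C) and cancellation. Only components can be cancelled, so left,
right and component occurrences are separate unknowns. It does follow: any solution of the short
inequalities yields an assignment whose values are exact on components, at least the left unknowns
on `Γ` and at most the right unknowns on `Δ`, and validity of the goal closes the gap. -/

namespace Lukasiewicz

/-! ### Linear algebra: Farkas' lemma in multiset form. -/

section Farkas

/-- Farkas' lemma for finitely many linear functionals over an ordered field. -/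
theorem exists_nonneg_combination {K V ι : Type*} [Field K] [LinearOrder K]
    [IsStrictOrderedRing K] [AddCommGroup V] [Module K V] (s : Finset ι) :
    ∀ (a : ι → V →ₗ[K] K) (b : V →ₗ[K] K),
      (∀ x, (∀ i ∈ s, 0 ≤ a i x) → 0 ≤ b x) →
      ∃ c : ι → K, (∀ i, 0 ≤ c i) ∧ ∀ x, b x = ∑ i ∈ s, c i * a i x := by
  classical
  induction s using Finset.induction_on with
  | empty =>
    intro a b h
    refine ⟨0, fun _ => le_rfl, fun x => ?_⟩
    have h₁ := h x (by simp)
    have h₂ := h (-x) (by simp)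
    rw [map_neg] at h₂
    rw [Finset.sum_empty]
    linarith
  | insert j s hj ih =>
    intro a b h
    by_cases hs : ∀ x, (∀ i ∈ s, 0 ≤ a i x) → 0 ≤ b x
    · obtain ⟨c, hc, hb⟩ := ih a b hs
      refine ⟨fun i => if i = j then 0 else c i, fun i => ?_, fun x => ?_⟩
      · dsimp only
        split_ifs
        exacts [le_rfl, hc i]
      · rw [Finset.sum_insert hj, hb x]
        simp only [if_true, zero_mul, zero_add]
        refine Finset.sum_congr rfl fun i hi => ?_
        rw [if_neg (ne_of_mem_of_not_mem hi hj)]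
    · push Not at hs
      obtain ⟨z, hz, hbz⟩ := hs
      have hjz : a j z < 0 := by
        by_contra hcon
        refine absurd (h z fun i hi => ?_) (not_le.2 hbz)
        rcases Finset.mem_insert.1 hi with rfl | hi
        exacts [not_lt.1 hcon, hz i hi]
      have hpos : 0 < (-(a j z))⁻¹ := inv_pos.2 (neg_pos.2 hjz)
      -- Normalised so that `a j y = -1`: then `x ↦ x + a j x • y` projects onto the kernel of `a
      -- j`, and the induction hypothesis is applied to the functionals composed with this
      -- projection.
      obtain ⟨y, hy⟩ : ∃ y, y = (-(a j z))⁻¹ • z := ⟨_, rfl⟩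
      have hay : ∀ i ∈ s, 0 ≤ a i y := fun i hi => by
        rw [hy, map_smul, smul_eq_mul]
        exact mul_nonneg hpos.le (hz i hi)
      have hby : b y < 0 := by
        rw [hy, map_smul, smul_eq_mul]
        exact mul_neg_of_pos_of_neg hpos hbz
      have hjy : a j y = -1 := by
        rw [hy, map_smul, smul_eq_mul]
        field_simp [hjz.ne]
      obtain ⟨c, hc, hb⟩ := ih (fun i => a i + (a i y) • a j) (b + (b y) • a j) (by
        intro x hx
        have key := h (x + (a j x) • y) (fun i hi => by
          rcases Finset.mem_insert.1 hi with rfl | hi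
          · simp [hjy]
          · have := hx i hi
            simp only [LinearMap.add_apply, LinearMap.smul_apply, smul_eq_mul] at this
            simp only [map_add, map_smul, smul_eq_mul]
            linarith)
        simp only [map_add, map_smul, smul_eq_mul] at key
        simp only [LinearMap.add_apply, LinearMap.smul_apply, smul_eq_mul]
        linarith)
      have hsum : 0 ≤ ∑ i ∈ s, c i * a i y :=
        Finset.sum_nonneg fun i hi => mul_nonneg (hc i) (hay i hi)
      refine ⟨fun i => if i = j then (∑ i ∈ s, c i * a i y) - b y else c i, fun i => ?_,
        fun x => ?_⟩
      · dsimp only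
        split_ifs
        exacts [by linarith, hc i]
      · rw [Finset.sum_insert hj]
        simp only [if_true]
        have hx := hb x
        simp only [LinearMap.add_apply, LinearMap.smul_apply, smul_eq_mul] at hx
        have e₁ : ∑ i ∈ s, (if i = j then (∑ i ∈ s, c i * a i y) - b y else c i) * a i x =
            ∑ i ∈ s, c i * a i x :=
          Finset.sum_congr rfl fun i hi => by rw [if_neg (ne_of_mem_of_not_mem hi hj)]
        have e₂ : ∑ i ∈ s, c i * (a i x + a i y * a j x) =
            ∑ i ∈ s, c i * a i x + (∑ i ∈ s, c i * a i y) * a j x := by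
          rw [Finset.sum_mul, ← Finset.sum_add_distrib]
          exact Finset.sum_congr rfl fun i _ => by ring
        rw [e₁]
        rw [e₂] at hx
        linarith

/-- Finitely many nonnegative rationals have a common denominator. -/
theorem exists_common_denominator {ι : Type*} (s : Finset ι) (c : ι → ℚ) (hc : ∀ i, 0 ≤ c i) :
    ∃ n : ℕ, 0 < n ∧ ∃ k : ι → ℕ, ∀ i ∈ s, (k i : ℚ) = n * c i := by
  classical
  refine ⟨∏ i ∈ s, (c i).den, Finset.prod_pos fun i _ => (c i).den_pos,
    fun i => (∏ j ∈ s.erase i, (c j).den) * (c i).num.toNat, fun i hi => ?_⟩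
  rw [← Finset.mul_prod_erase s _ hi]
  push_cast
  have h₁ : (((c i).num.toNat : ℕ) : ℚ) = (c i).num := by
    exact_mod_cast Int.toNat_of_nonneg (Rat.num_nonneg.2 (hc i))
  have h₂ : ((c i).den : ℚ) * c i = (c i).num := Rat.den_mul_eq_num (c i)
  rw [h₁, ← h₂]
  ring

/-- The sum of the values of a function over a multiset, as a linear functional. -/
def multisetEval {κ : Type*} (m : Multiset κ) : (κ → ℚ) →ₗ[ℚ] ℚ where
  toFun x := (m.map x).sum
  map_add' x y := by simp [Multiset.sum_map_add]
  map_smul' r x := by simp [Multiset.sum_map_mul_left]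

theorem multisetEval_apply {κ : Type*} (m : Multiset κ) (x : κ → ℚ) :
    multisetEval m x = (m.map x).sum := rfl

/-- Testing on indicators turns an identity between functionals into one between multiplicities. -/
theorem multisetEval_single {κ : Type*} [DecidableEq κ] (m : Multiset κ) (t : κ) :
    multisetEval m (fun j => if t = j then 1 else 0) = m.count t := by
  rw [multisetEval_apply]
  induction m using Multiset.induction_on with
  | empty => simp
  | cons a m ih =>
    rw [Multiset.map_cons, Multiset.sum_cons, ih, Multiset.count_cons]
    split_ifs <;> push_cast <;> ring

/-- If an inequality between multiset sums follows from finitely many others, then a positive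
multiple of it is, up to cancellation, a sum of multiples of them. -/
theorem exists_multiset_combination {κ ι : Type*} (s : Finset ι) (l r : ι → Multiset κ)
    (Γ Δ : Multiset κ)
    (h : ∀ x : κ → ℚ, (∀ i ∈ s, ((l i).map x).sum ≤ ((r i).map x).sum) →
      (Γ.map x).sum ≤ (Δ.map x).sum) :
    ∃ n : ℕ, 0 < n ∧ ∃ k : ι → ℕ,
      n • Γ + ∑ i ∈ s, k i • r i = n • Δ + ∑ i ∈ s, k i • l i := by
  classical
  obtain ⟨c, hc, hb⟩ := exists_nonneg_combination s
    (fun i => multisetEval (r i) - multisetEval (l i)) (multisetEval Δ - multisetEval Γ) (by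
      intro x hx
      simp only [LinearMap.sub_apply, multisetEval_apply, sub_nonneg] at hx ⊢
      exact h x hx)
  obtain ⟨n, hn, k, hk⟩ := exists_common_denominator s c hc
  refine ⟨n, hn, k, Multiset.ext.2 fun t => ?_⟩
  have ht := hb (fun j => if t = j then 1 else 0)
  simp only [LinearMap.sub_apply, multisetEval_single] at ht
  have hs : (n : ℚ) * (Δ.count t - Γ.count t) =
      ∑ i ∈ s, (k i : ℚ) * ((r i).count t - (l i).count t) := by
    rw [ht, Finset.mul_sum]
    refine Finset.sum_congr rfl fun i hi => ?_
    rw [hk i hi]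
    ring
  simp only [mul_sub, Finset.sum_sub_distrib] at hs
  simp only [Multiset.count_add, Multiset.count_nsmul, Multiset.count_sum']
  have : ((n * Γ.count t + ∑ i ∈ s, k i * (r i).count t : ℕ) : ℚ) =
      ((n * Δ.count t + ∑ i ∈ s, k i * (l i).count t : ℕ) : ℚ) := by
    push_cast
    linarith
  exact_mod_cast this

end Farkas

/-! ### Soundness. -/

section Soundness

theorem GLs.valid {S : Sequent} (h : GLs S) : S.Valid := by
  induction h with
  | id A => intro v; exact le_rfl
  | empty => intro v; exact le_rfl
  | bot A =>
    intro v
    simp only [Multiset.map_singleton, Multiset.sum_singleton, v.map_bot]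
    exact (v.val A).2.1
  | weak Γ Δ A _ ih =>
    intro v
    have h₁ := ih v
    have h₂ := (v.val A).2.2
    simp only [Multiset.map_add, Multiset.sum_add, Multiset.map_singleton,
      Multiset.sum_singleton] at *
    linarith
  | mix Γ₁ Γ₂ Δ₁ Δ₂ _ _ ih₁ ih₂ =>
    intro v
    have h₁ := ih₁ v
    have h₂ := ih₂ v
    simp only [Multiset.map_add, Multiset.sum_add] at *
    linarith
  | contr n Γ Δ hn _ ih =>
    intro v
    have h₁ := ih v
    simp only [Multiset.map_nsmul, Multiset.sum_nsmul, nsmul_eq_mul] at h₁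
    exact le_of_mul_le_mul_left h₁ (Nat.cast_pos.2 hn)
  -- Premise and conclusion express the same inequality, since `min 0 (b - a) - min 0 (a - b) = b -
  -- a`.
  | impL Γ Δ A B _ ih =>
    intro v
    have h₁ := ih v
    simp only [Multiset.map_add, Multiset.sum_add, Multiset.map_singleton,
      Multiset.sum_singleton, v.map_imp, Carrier.coe_imp] at *
    rcases le_total (v.val A : ℝ) (v.val B) with h | h
    · rw [min_eq_left (by linarith)]
      rw [min_eq_right (by linarith)] at h₁
      linarith
    · rw [min_eq_right (by linarith)]
      rw [min_eq_left (by linarith)] at h₁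
      linarith
  | impR Γ Δ A B _ _ ih₁ ih₂ =>
    intro v
    have h₁ := ih₁ v
    have h₂ := ih₂ v
    simp only [Multiset.map_add, Multiset.sum_add, Multiset.map_singleton,
      Multiset.sum_singleton, v.map_imp, Carrier.coe_imp] at *
    rcases le_total (v.val A : ℝ) (v.val B) with h | h
    · rw [min_eq_left (by linarith)]
      linarith
    · rw [min_eq_right (by linarith)]
      linarith

end Soundness

/-! ### Derived rules: cancellation and case distinction. -/

section Derived

theorem GLs.of_eq {Γ Δ Γ' Δ' : Multiset Formula} (h : GLs ⟨Γ, Δ⟩) (hΓ : Γ = Γ') (hΔ : Δ = Δ') :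
    GLs ⟨Γ', Δ'⟩ := hΓ ▸ hΔ ▸ h

theorem GLs.weaken {Γ Δ : Multiset Formula} (h : GLs ⟨Γ, Δ⟩) (Θ : Multiset Formula) :
    GLs ⟨Γ + Θ, Δ⟩ := by
  induction Θ using Multiset.induction_on with
  | empty => simpa using h
  | cons A Θ ih =>
    exact (GLs.weak _ _ A ih).of_eq (by rw [← Multiset.singleton_add]; abel) rfl

theorem GLs.weaken_of_le {Γ Γ' Δ : Multiset Formula} (h : GLs ⟨Γ, Δ⟩) (hle : Γ ≤ Γ') :
    GLs ⟨Γ', Δ⟩ := by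
  obtain ⟨Θ, rfl⟩ := Multiset.le_iff_exists_add.1 hle
  exact h.weaken Θ

theorem GLs.nsmul {Γ Δ : Multiset Formula} (h : GLs ⟨Γ, Δ⟩) (n : ℕ) :
    GLs ⟨n • Γ, n • Δ⟩ := by
  induction n with
  | zero => simpa using GLs.empty
  | succ n ih => simpa only [succ_nsmul] using GLs.mix _ _ _ _ ih h

theorem GLs.modusPonens (A B : Formula) : GLs ⟨{A} + {A.imp B}, {B}⟩ := by
  apply GLs.impL
  exact (((GLs.id A).mix _ _ _ _ (GLs.id B)).weak _ _ (B.imp A)).of_eq rfl (by abel)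

/-- `IsComponent Γ X`: the formula `X` is an immediate subformula of an implication in `Γ`. -/
def IsComponent (Γ : Multiset Formula) (X : Formula) : Prop :=
  ∃ Y, Formula.imp X Y ∈ Γ ∨ Formula.imp Y X ∈ Γ

theorem IsComponent.mono {Γ Γ' : Multiset Formula} {X : Formula} (h : IsComponent Γ X)
    (hsub : Γ ⊆ Γ') : IsComponent Γ' X := by
  obtain ⟨Y, hY⟩ := h
  exact ⟨Y, hY.imp (fun h => hsub h) (fun h => hsub h)⟩

/-- Two uses of (⇒,l), on `X ⇒ Y` and then on the resulting `Y ⇒ X`, bring `X ⇒ Y` back with `X` and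
`Y` added on both sides. -/
theorem GLs.cancel_imp {Γ Δ : Multiset Formula} {X Y : Formula}
    (h : GLs ⟨Γ + {X.imp Y} + {X} + {Y}, Δ + {X} + {Y}⟩) : GLs ⟨Γ + {X.imp Y}, Δ⟩ := by
  apply GLs.impL
  refine GLs.impL (Γ + {Y}) (Δ + {X}) Y X (h.of_eq ?_ ?_) <;> abel

/-- Components of left implications may be cancelled. -/
theorem GLs.cancel {Γ Δ : Multiset Formula} {X : Formula} (hX : IsComponent Γ X)
    (h : GLs ⟨Γ + {X}, Δ + {X}⟩) : GLs ⟨Γ, Δ⟩ := by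
  obtain ⟨Y, hY | hY⟩ := hX
  all_goals
    obtain ⟨Θ, rfl⟩ := Multiset.exists_cons_of_mem hY
    rw [← Multiset.singleton_add, add_comm] at h ⊢
    refine GLs.cancel_imp ((h.mix _ _ _ _ (GLs.id Y)).of_eq ?_ ?_) <;> abel

theorem GLs.cancel_multiset {Γ Δ : Multiset Formula} (Z : Multiset Formula)
    (hZ : ∀ X ∈ Z, IsComponent Γ X) (h : GLs ⟨Γ + Z, Δ + Z⟩) : GLs ⟨Γ, Δ⟩ := by
  induction Z using Multiset.induction_on with
  | empty => simpa using h
  | cons X Z ih =>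
    refine ih (fun Y hY => hZ Y (Multiset.mem_cons_of_mem hY)) ?_
    refine GLs.cancel (X := X) ((hZ X (Multiset.mem_cons_self X Z)).mono
      (Multiset.subset_of_le (Multiset.le_add_right _ _))) (h.of_eq ?_ ?_) <;>
    · rw [← Multiset.singleton_add]
      abel

/-- Case distinction on the order of `C` and `D`, when `C ⇒ D` is a component. -/
theorem GLs.split {Γ Δ : Multiset Formula} {C D : Formula} (hX : IsComponent Γ (C.imp D))
    (h₁ : GLs ⟨Γ + {C.imp D}, Δ⟩) (h₂ : GLs ⟨Γ + {D.imp C}, Δ⟩) : GLs ⟨Γ, Δ⟩ := by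
  -- Insert `C ⇒ D` on both sides and apply (⇒,r); in its second premise, (⇒,l) exchanges the left
  -- `C ⇒ D` for `D ⇒ C`.
  refine GLs.cancel hX (GLs.impR _ _ _ _ h₁ ?_)
  refine (GLs.impL (Γ + {C}) (Δ + {D}) C D ?_).of_eq (by abel) rfl
  refine ((h₂.mix _ _ _ _ (GLs.id C)).mix _ _ _ _ (GLs.id D)).of_eq ?_ ?_ <;> abel

/-- Pigeonhole: after `2 * N` successive splits, one of the two implications has been added at least
`N` times on each branch. -/
theorem GLs.split_nsmul {Γ Δ : Multiset Formula} {C D : Formula} (N : ℕ)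
    (hX : IsComponent Γ (C.imp D)) (h₁ : GLs ⟨Γ + N • {C.imp D}, Δ⟩)
    (h₂ : GLs ⟨Γ + N • {D.imp C}, Δ⟩) : GLs ⟨Γ, Δ⟩ := by
  have key : ∀ k i j : ℕ, i + j + k = 2 * N →
      GLs ⟨Γ + i • {C.imp D} + j • {D.imp C}, Δ⟩ := by
    intro k
    induction k with
    | zero =>
      intro i j hij
      rcases le_total N i with hi | hi
      · refine (h₁.weaken ((i - N) • {C.imp D} + j • {D.imp C})).of_eq ?_ rfl
        conv_rhs => rw [← Nat.add_sub_of_le hi, add_nsmul]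
        abel
      · have hj : N ≤ j := by omega
        refine (h₂.weaken (i • {C.imp D} + (j - N) • {D.imp C})).of_eq ?_ rfl
        conv_rhs => rw [← Nat.add_sub_of_le hj, add_nsmul]
        abel
    | succ k ih =>
      intro i j hij
      refine GLs.split (C := C) (D := D) (hX.mono ?_) ?_ ?_
      · rw [add_assoc]
        exact Multiset.subset_of_le (Multiset.le_add_right _ _)
      · refine (ih (i + 1) j (by omega)).of_eq ?_ rfl
        rw [succ_nsmul]
        abel
      · refine (ih i (j + 1) (by omega)).of_eq ?_ rfl
        rw [succ_nsmul]
        abel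
  simpa using key (2 * N) 0 0 (by omega)

/-! ### Derivability with reusable hypotheses. -/

/-- Derivability of `Γ ⊢ Δ` when the formulas of `H` may be used arbitrarily often on the left. -/
def DerivableUnder (H Γ Δ : Multiset Formula) : Prop := ∃ N : ℕ, GLs ⟨Γ + N • H, Δ⟩

variable {H Γ Δ Γ' Δ' : Multiset Formula}

theorem GLs.derivableUnder (h : GLs ⟨Γ, Δ⟩) : DerivableUnder H Γ Δ := ⟨0, by simpa using h⟩

theorem GLs.derivableUnder_of_mem {A : Formula} (hA : A ∈ H) (h : GLs ⟨Γ + {A}, Δ⟩) :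
    DerivableUnder H Γ Δ :=
  ⟨1, h.weaken_of_le (by simpa using hA)⟩

theorem DerivableUnder.add (h : DerivableUnder H Γ Δ) (h' : DerivableUnder H Γ' Δ') :
    DerivableUnder H (Γ + Γ') (Δ + Δ') := by
  obtain ⟨N, h⟩ := h
  obtain ⟨N', h'⟩ := h'
  refine ⟨N + N', (h.mix _ _ _ _ h').of_eq ?_ rfl⟩
  rw [add_nsmul]
  abel

theorem DerivableUnder.nsmul (h : DerivableUnder H Γ Δ) (n : ℕ) :
    DerivableUnder H (n • Γ) (n • Δ) := by
  obtain ⟨N, h⟩ := h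
  refine ⟨n * N, (h.nsmul n).of_eq ?_ rfl⟩
  rw [nsmul_add, mul_nsmul']

theorem DerivableUnder.sum {ι : Type*} (s : Finset ι) (k : ι → ℕ) (l r : ι → Multiset Formula)
    (h : ∀ i ∈ s, DerivableUnder H (l i) (r i)) :
    DerivableUnder H (∑ i ∈ s, k i • l i) (∑ i ∈ s, k i • r i) := by
  classical
  induction s using Finset.induction_on with
  | empty => exact GLs.empty.derivableUnder
  | insert j s hj ih =>
    rw [Finset.sum_insert hj, Finset.sum_insert hj]
    exact ((h j (Finset.mem_insert_self _ _)).nsmul _).add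
      (ih fun i hi => h i (Finset.mem_insert_of_mem hi))

theorem DerivableUnder.contract {n : ℕ} (hn : 0 < n) (h : DerivableUnder H (n • Γ) (n • Δ)) :
    DerivableUnder H Γ Δ := by
  obtain ⟨N, h⟩ := h
  refine ⟨N, GLs.contr n _ _ hn (h.weaken_of_le ?_)⟩
  rw [nsmul_add]
  refine add_le_add le_rfl ?_
  calc N • H = 1 • (N • H) := (one_nsmul _).symm
    _ ≤ n • (N • H) := nsmul_le_nsmul_left (Multiset.zero_le _) hn

theorem DerivableUnder.cancel_multiset (Z : Multiset Formula)
    (hZ : ∀ X ∈ Z, IsComponent (Γ + H) X) (h : DerivableUnder H (Γ + Z) (Δ + Z)) :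
    DerivableUnder H Γ Δ := by
  obtain ⟨N, h⟩ := h
  -- The extra copy of `H` keeps its components available even when `N = 0`.
  refine ⟨N + 1, GLs.cancel_multiset Z (fun X hX => (hZ X hX).mono ?_) (h.weaken_of_le ?_)⟩
  · rw [succ_nsmul]
    exact Multiset.subset_of_le (add_le_add le_rfl (Multiset.le_add_left _ _))
  · calc Γ + Z + N • H ≤ Γ + Z + N • H + H := Multiset.le_add_right _ _
      _ = Γ + (N + 1) • H + Z := by rw [succ_nsmul]; abel

theorem DerivableUnder.split {C D : Formula} (hX : IsComponent (Γ + H) (C.imp D))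
    (h₁ : DerivableUnder (H + {C.imp D}) Γ Δ) (h₂ : DerivableUnder (H + {D.imp C}) Γ Δ) :
    DerivableUnder H Γ Δ := by
  obtain ⟨N₁, h₁⟩ := h₁
  obtain ⟨N₂, h₂⟩ := h₂
  refine ⟨N₁ + N₂ + 1, GLs.split_nsmul (N₁ + N₂ + 1) (C := C) (D := D) (hX.mono ?_)
    (h₁.weaken_of_le ?_) (h₂.weaken_of_le ?_)⟩
  · rw [succ_nsmul]
    exact Multiset.subset_of_le (add_le_add le_rfl (Multiset.le_add_left _ _))
  all_goals
    rw [add_assoc, ← nsmul_add]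
    exact add_le_add le_rfl (nsmul_le_nsmul_left (Multiset.zero_le _) (by omega))

end Derived

/-! ### Rational assignments with a free value for `⊥`. -/

section Semantics

/-- The extension to all formulas of an assignment `g` of the variables and a value `β` of `⊥`
(in place of `-1`). -/
def evalWith (g : ℕ → ℚ) (β : ℚ) : Formula → ℚ
  | .var i => g i
  | .bot => β
  | .imp A B => min 0 (evalWith g β B - evalWith g β A)

theorem evalWith_mem {g : ℕ → ℚ} {β : ℚ} (hβ : β ≤ 0) (hg : ∀ i, β ≤ g i ∧ g i ≤ 0)
    (F : Formula) : β ≤ evalWith g β F ∧ evalWith g β F ≤ 0 := by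
  induction F with
  | var i => exact hg i
  | bot => exact ⟨le_rfl, hβ⟩
  | imp A B ihA ihB =>
    exact ⟨le_min hβ (by linarith [ihA.2, ihB.1]), min_le_left _ _⟩

/-- The valuation obtained by rescaling `evalWith g β` so that `⊥` has the value `-1`. -/
noncomputable def rescaledValuation (g : ℕ → ℚ) (β : ℚ) (hβ : β < 0)
    (hg : ∀ i, β ≤ g i ∧ g i ≤ 0) : Valuation where
  val F := ⟨((evalWith g β F / -β : ℚ) : ℝ), by
    have h := evalWith_mem hβ.le hg F
    have hβ' : 0 < -β := neg_pos.2 hβ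
    have h₁ : -1 ≤ evalWith g β F / -β := by rw [le_div_iff₀ hβ']; linarith
    have h₂ : evalWith g β F / -β ≤ 0 := div_nonpos_of_nonpos_of_nonneg h.2 hβ'.le
    exact ⟨by exact_mod_cast h₁, by exact_mod_cast h₂⟩⟩
  map_bot := by
    apply Subtype.ext
    change ((β / -β : ℚ) : ℝ) = -1
    rw [div_neg, div_self hβ.ne]
    norm_num
  map_imp A B := by
    apply Subtype.ext
    rw [Carrier.coe_imp]
    change ((min 0 (evalWith g β B - evalWith g β A) / -β : ℚ) : ℝ) =
      min 0 (((evalWith g β B / -β : ℚ) : ℝ) - ((evalWith g β A / -β : ℚ) : ℝ))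
    rw [← min_div_div_right (neg_pos.2 hβ).le, zero_div, sub_div]
    push_cast
    rfl

/-- The inequality is homogeneous, so for `β < 0` one rescales to a valuation; for `β = 0` all
values vanish. -/
theorem Sequent.Valid.evalWith_le {Γ Δ : Multiset Formula} (h : Sequent.Valid ⟨Γ, Δ⟩)
    {g : ℕ → ℚ} {β : ℚ} (hβ : β ≤ 0) (hg : ∀ i, β ≤ g i ∧ g i ≤ 0) :
    (Γ.map (evalWith g β)).sum ≤ (Δ.map (evalWith g β)).sum := by
  rcases hβ.lt_or_eq with hβ' | rfl
  · have hv := h (rescaledValuation g β hβ' hg)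
    have key : ∀ Θ : Multiset Formula,
        (Θ.map fun A => ((rescaledValuation g β hβ' hg).val A : ℝ)).sum =
          (((Θ.map (evalWith g β)).sum / -β : ℚ) : ℝ) := by
      intro Θ
      rw [← Multiset.sum_map_div, ← Rat.coe_castHom, map_multiset_sum, Multiset.map_map]
      rfl
    simp only [key] at hv
    have hq : (Γ.map (evalWith g β)).sum / -β ≤ (Δ.map (evalWith g β)).sum / -β := by
      exact_mod_cast hv
    exact (div_le_div_iff_of_pos_right (neg_pos.2 hβ')).1 hq
  · have h0 : evalWith g 0 = fun _ => 0 :=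
      funext fun F => le_antisymm (evalWith_mem le_rfl hg F).2 (evalWith_mem le_rfl hg F).1
    simp [h0]

end Semantics

/-! ### Completeness. -/

section Completeness

/-- `Decided H F`: if `F` is an implication `C ⇒ D`, then `H` contains it or its converse. -/
def Decided (H : Multiset Formula) : Formula → Prop
  | .imp C D => Formula.imp C D ∈ H ∨ Formula.imp D C ∈ H
  | _ => True

/-- The roles that a formula occurrence can play in a linear combination of sequents: on the left
or right of the goal, or as a component that may be cancelled. -/
inductive Role : Type
  | left
  | right
  | inner

/-- The formulas of `Γ` tagged with the role `ρ`. -/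
def tag (ρ : Role) (Γ : Multiset Formula) : Multiset (Role × Formula) := Γ.map (Prod.mk ρ)

theorem tag_add (ρ : Role) (Γ Δ : Multiset Formula) : tag ρ (Γ + Δ) = tag ρ Γ + tag ρ Δ :=
  Multiset.map_add _ _ _

theorem tag_nsmul (ρ : Role) (n : ℕ) (Γ : Multiset Formula) : tag ρ (n • Γ) = n • tag ρ Γ :=
  Multiset.map_nsmul _ _ _

theorem tag_sum {ι : Type*} (ρ : Role) (s : Finset ι) (f : ι → Multiset Formula) :
    tag ρ (∑ i ∈ s, f i) = ∑ i ∈ s, tag ρ (f i) :=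
  map_sum (Multiset.mapAddMonoidHom (Prod.mk ρ)) _ _

theorem eq_of_tag_add_eq {a b c a' b' c' : Multiset Formula}
    (h : tag .left a + tag .right b + tag .inner c =
      tag .left a' + tag .right b' + tag .inner c') : a = a' ∧ b = b' ∧ c = c' := by
  classical
  have key : ∀ ρ : Role, ∀ F : Formula, ∀ m : Multiset Formula, ∀ σ : Role,
      (tag σ m).count (ρ, F) = if σ = ρ then m.count F else 0 := by
    intro ρ F m σ
    split_ifs with hσ
    · subst hσ
      exact Multiset.count_map_eq_count' _ _ (Prod.mk_right_injective σ) _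
    · refine Multiset.count_eq_zero.2 fun hm => ?_
      obtain ⟨G, -, hG⟩ := Multiset.mem_map.1 hm
      exact hσ (congrArg Prod.fst hG)
  refine ⟨Multiset.ext.2 fun F => ?_, Multiset.ext.2 fun F => ?_, Multiset.ext.2 fun F => ?_⟩
  · simpa [key] using congrArg (Multiset.count (Role.left, F)) h
  · simpa [key] using congrArg (Multiset.count (Role.right, F)) h
  · simpa [key] using congrArg (Multiset.count (Role.inner, F)) h

theorem sum_map_tag (ρ : Role) (Γ : Multiset Formula) (x : Role × Formula → ℚ) :
    ((tag ρ Γ).map x).sum = (Γ.map fun F => x (ρ, F)).sum := by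
  rw [tag, Multiset.map_map]
  rfl

/-- The linear inequalities, over the formulas of `T`, that the tagged values have to satisfy
because of short derivable sequents. -/
def SatisfiesDerivable (H Γ : Multiset Formula) (T : Finset Formula) (x : Role × Formula → ℚ) :
    Prop :=
  ∀ a b c d : Multiset Formula, a ≤ T.val + T.val → b ≤ T.val + T.val → c ≤ T.val + T.val →
    d ≤ T.val + T.val → (∀ X ∈ c + d, IsComponent (Γ + H) X) →
    DerivableUnder H (a + c) (b + d) →
    (a.map fun F => x (.left, F)).sum + (c.map fun F => x (.inner, F)).sum ≤
      (b.map fun F => x (.right, F)).sum + (d.map fun F => x (.inner, F)).sum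

/-- If the inequality of a sequent follows from those of the short derivable sequents, then the
sequent is derivable. -/
theorem derivableUnder_of_satisfies {H Γ Δ : Multiset Formula} (T : Finset Formula)
    (h : ∀ x, SatisfiesDerivable H Γ T x →
      (Γ.map fun F => x (.left, F)).sum ≤ (Δ.map fun F => x (.right, F)).sum) :
    DerivableUnder H Γ Δ := by
  classical
  let P : Finset (Multiset Formula) := (T.val + T.val).powerset.toFinset
  have hP : ∀ m, m ∈ P ↔ m ≤ T.val + T.val := by simp [P]
  let s : Finset ((Multiset Formula × Multiset Formula) × Multiset Formula × Multiset Formula) :=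
    ((P ×ˢ P) ×ˢ P ×ˢ P).filter fun q =>
      (∀ X ∈ q.2.1 + q.2.2, IsComponent (Γ + H) X) ∧
        DerivableUnder H (q.1.1 + q.2.1) (q.1.2 + q.2.2)
  have hs : ∀ a b c d, ((a, b), c, d) ∈ s ↔ ((a ≤ T.val + T.val ∧ b ≤ T.val + T.val) ∧
      c ≤ T.val + T.val ∧ d ≤ T.val + T.val) ∧ (∀ X ∈ c + d, IsComponent (Γ + H) X) ∧
        DerivableUnder H (a + c) (b + d) := by
    intro a b c d
    simp only [s, Finset.mem_filter, Finset.mem_product, hP]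
  obtain ⟨n, hn, k, hk⟩ := exists_multiset_combination s
    (fun q => tag .left q.1.1 + tag .inner q.2.1) (fun q => tag .right q.1.2 + tag .inner q.2.2)
    (tag .left Γ) (tag .right Δ) (by
      intro x hx
      simp only [sum_map_tag]
      refine h x fun a b c d ha hb hc hd hcd hder => ?_
      have := hx ((a, b), c, d) ((hs a b c d).2 ⟨⟨⟨ha, hb⟩, hc, hd⟩, hcd, hder⟩)
      simpa only [Multiset.map_add, Multiset.sum_add, sum_map_tag] using this)
  simp only [nsmul_add, Finset.sum_add_distrib, ← tag_sum, ← tag_nsmul] at hk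
  -- Comparing tags: the left parts of the combined sequents sum exactly to `n • Γ`, the right parts
  -- to `n • Δ`, and the component parts agree on both sides, hence can be cancelled.
  obtain ⟨e₁, e₂, e₃⟩ := eq_of_tag_add_eq (a := n • Γ) (a' := ∑ q ∈ s, k q • q.1.1)
    (b := ∑ q ∈ s, k q • q.1.2) (b' := n • Δ) (by
      rw [add_assoc, hk]
      abel)
  refine DerivableUnder.contract hn
    (DerivableUnder.cancel_multiset (∑ q ∈ s, k q • q.2.1) (fun X hX => ?_) ?_)
  · obtain ⟨q, hq, hXq⟩ := Multiset.mem_sum.1 hX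
    have hq' := ((hs q.1.1 q.1.2 q.2.1 q.2.2).1 hq).2.1 X
      (Multiset.mem_add.2 (Or.inl (Multiset.mem_of_mem_nsmul hXq)))
    refine hq'.mono (Multiset.subset_of_le (add_le_add ?_ le_rfl))
    calc Γ = 1 • Γ := (one_nsmul _).symm
      _ ≤ n • Γ := nsmul_le_nsmul_left (Multiset.zero_le _) hn
  · have hsum := DerivableUnder.sum s k (fun q => q.1.1 + q.2.1) (fun q => q.1.2 + q.2.2)
      (fun q hq => ((hs q.1.1 q.1.2 q.2.1 q.2.2).1 hq).2.2)
    simp only [nsmul_add, Finset.sum_add_distrib] at hsum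
    rwa [← e₁, e₂, e₃] at hsum

/-- Completeness when the right side is atomic and the hypotheses decide the order of the
immediate subformulas of every component. -/
theorem derivableUnder_of_decided {H Γ Δ : Multiset Formula} (T : Finset Formula)
    (hbot : Formula.bot ∈ T) (hΓ : ∀ F ∈ Γ, F ∈ T) (hΔ : ∀ F ∈ Δ, F ∈ T)
    (hT : ∀ X, IsComponent (Γ + H) X → X ∈ T) (hdec : ∀ X, IsComponent (Γ + H) X → Decided H X)
    (hatom : ∀ A B, Formula.imp A B ∉ Δ) (hvalid : Sequent.Valid ⟨Γ, Δ⟩) :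
    DerivableUnder H Γ Δ := by
  classical
  refine derivableUnder_of_satisfies T fun x hx => ?_
  have hone : ∀ F ∈ T, ({F} : Multiset Formula) ≤ T.val + T.val := fun F hF =>
    Multiset.singleton_le.2 (Multiset.mem_add.2 (Or.inl hF))
  have htwo : ∀ F ∈ T, ∀ G ∈ T, ({F} + {G} : Multiset Formula) ≤ T.val + T.val :=
    fun F hF G hG => add_le_add (Multiset.singleton_le.2 hF) (Multiset.singleton_le.2 hG)
  have hzero : (0 : Multiset Formula) ≤ T.val + T.val := Multiset.zero_le _
  -- the value of a formula read from its component occurrences if there are any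
  let e : Formula → ℚ := fun F => if IsComponent (Γ + H) F then x (.inner, F) else x (.left, F)
  have he : ∀ F, IsComponent (Γ + H) F → e F = x (.inner, F) := fun F hF => if_pos hF
  have he' : ∀ F, ¬ IsComponent (Γ + H) F → e F = x (.left, F) := fun F hF => if_neg hF
  have hleft : ∀ F ∈ T, x (.left, F) ≤ e F := by
    intro F hF
    by_cases hc : IsComponent (Γ + H) F
    · rw [he F hc]
      simpa using hx {F} 0 0 {F} (hone F hF) hzero hzero (hone F hF) (by simpa using hc)
        (by simpa using (GLs.id F).derivableUnder)
    · rw [he' F hc]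
  have hrel : ∀ F ∈ T, ∀ G ∈ T, GLs ⟨{F}, {G}⟩ → e F ≤ x (.right, G) := by
    intro F hF G hG hFG
    by_cases hc : IsComponent (Γ + H) F
    · rw [he F hc]
      simpa using hx 0 {G} {F} 0 hzero (hone G hG) (hone F hF) hzero (by simpa using hc)
        (by simpa using hFG.derivableUnder)
    · rw [he' F hc]
      simpa using hx {F} {G} 0 0 (hone F hF) (hone G hG) hzero hzero (by simp)
        (by simpa using hFG.derivableUnder)
  have hrel' : ∀ F ∈ T, ∀ G, IsComponent (Γ + H) G → GLs ⟨{F}, {G}⟩ → e F ≤ e G := by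
    intro F hF G hG hFG
    rw [he G hG]
    by_cases hc : IsComponent (Γ + H) F
    · rw [he F hc]
      simpa using hx 0 0 {F} {G} hzero hzero (hone F hF) (hone G (hT G hG))
        (by simpa using ⟨hc, hG⟩) (by simpa using hFG.derivableUnder)
    · rw [he' F hc]
      simpa using hx {F} 0 0 {G} (hone F hF) hzero hzero (hone G (hT G hG))
        (by simpa using hG) (by simpa using hFG.derivableUnder)
  have hnonpos : ∀ F ∈ T, e F ≤ 0 := by
    intro F hF
    have hder : GLs ⟨{F}, 0⟩ := by simpa using GLs.empty.weak _ _ F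
    by_cases hc : IsComponent (Γ + H) F
    · rw [he F hc]
      simpa using hx 0 0 {F} 0 hzero hzero (hone F hF) hzero (by simpa using hc)
        (by simpa using hder.derivableUnder)
    · rw [he' F hc]
      simpa using hx {F} 0 0 0 (hone F hF) hzero hzero hzero (by simp)
        (by simpa using hder.derivableUnder)
  let β : ℚ := e .bot
  -- The maximum is needed because a variable occurring only outside components may have a left
  -- unknown below `β`.
  let g : ℕ → ℚ := fun i => if Formula.var i ∈ T then max β (e (.var i)) else 0
  have hβ : β ≤ 0 := hnonpos _ hbot
  have hg : ∀ i, β ≤ g i ∧ g i ≤ 0 := by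
    intro i
    dsimp only [g]
    split_ifs with hi
    exacts [⟨le_max_left _ _, max_le hβ (hnonpos _ hi)⟩, ⟨hβ, le_rfl⟩]
  have hinner : ∀ F, IsComponent (Γ + H) F → evalWith g β F = x (.inner, F) := by
    intro F
    induction F with
    | var i =>
      intro hc
      rw [← he _ hc]
      change g i = _
      dsimp only [g]
      rw [if_pos (hT _ hc), max_eq_right (hrel' _ hbot _ hc (GLs.bot _))]
    | bot => exact fun hc => he _ hc
    | imp C D ihC ihD =>
      intro hc
      -- Either alternative makes `C` and `D` components too, so the induction hypotheses apply.
      have hCD : Formula.imp C D ∈ H ∨ Formula.imp D C ∈ H := hdec _ hc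
      have hC : IsComponent (Γ + H) C := hCD.elim
        (fun h => ⟨D, Or.inl (Multiset.mem_add.2 (Or.inr h))⟩)
        (fun h => ⟨D, Or.inr (Multiset.mem_add.2 (Or.inr h))⟩)
      have hD : IsComponent (Γ + H) D := hCD.elim
        (fun h => ⟨C, Or.inr (Multiset.mem_add.2 (Or.inr h))⟩)
        (fun h => ⟨C, Or.inl (Multiset.mem_add.2 (Or.inr h))⟩)
      have h₀ : x (.inner, C.imp D) ≤ 0 := by
        rw [← he _ hc]
        exact hnonpos _ (hT _ hc)
      have h₁ : x (.inner, C) + x (.inner, C.imp D) ≤ x (.inner, D) := by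
        simpa using hx 0 0 ({C} + {C.imp D}) {D} hzero hzero (htwo _ (hT _ hC) _ (hT _ hc))
          (hone _ (hT _ hD))
          (by
            intro X hX
            simp only [Multiset.mem_add, Multiset.mem_singleton] at hX
            rcases hX with (rfl | rfl) | rfl <;> assumption)
          (by simpa only [zero_add] using (GLs.modusPonens C D).derivableUnder)
      change min 0 (evalWith g β D - evalWith g β C) = _
      rw [ihC hC, ihD hD]
      refine le_antisymm ?_ (le_min h₀ (by linarith))
      rcases hCD with hH | hH
      · refine (min_le_left _ _).trans ?_
        simpa using hx 0 0 0 {C.imp D} hzero hzero hzero (hone _ (hT _ hc)) (by simpa using hc)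
          (GLs.derivableUnder_of_mem hH (by simpa using GLs.id (C.imp D)))
      · refine (min_le_right _ _).trans ?_
        have h₂ : x (.inner, D) ≤ x (.inner, C) + x (.inner, C.imp D) := by
          simpa using hx 0 0 {D} ({C} + {C.imp D}) hzero hzero (hone _ (hT _ hD))
            (htwo _ (hT _ hC) _ (hT _ hc))
            (by
              intro X hX
              simp only [Multiset.mem_add, Multiset.mem_singleton] at hX
              rcases hX with rfl | rfl | rfl <;> assumption)
            (by
              simp only [zero_add]
              refine GLs.derivableUnder_of_mem hH (GLs.impR _ _ _ _ (GLs.modusPonens D C) ?_)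
              refine ((GLs.id C).mix _ _ _ _ (GLs.id D)).weaken {D.imp C} |>.of_eq ?_ rfl
              abel)
        linarith
  have hL : ∀ F ∈ Γ, x (.left, F) ≤ evalWith g β F := by
    intro F hF
    have hFT := hΓ F hF
    match F with
    | .var i =>
      change _ ≤ g i
      dsimp only [g]
      rw [if_pos hFT]
      exact (hleft _ hFT).trans (le_max_right _ _)
    | .bot => exact hleft _ hFT
    | .imp C D =>
      have hC : IsComponent (Γ + H) C := ⟨D, Or.inl (Multiset.mem_add.2 (Or.inl hF))⟩
      have hD : IsComponent (Γ + H) D := ⟨C, Or.inr (Multiset.mem_add.2 (Or.inl hF))⟩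
      refine le_min ((hleft _ hFT).trans (hnonpos _ hFT)) ?_
      rw [hinner C hC, hinner D hD]
      have h₁ : x (.left, C.imp D) + x (.inner, C) ≤ x (.inner, D) := by
        simpa using hx {C.imp D} 0 {C} {D} (hone _ hFT) hzero (hone _ (hT _ hC))
          (hone _ (hT _ hD)) (by simpa using ⟨hC, hD⟩)
          (by simpa only [zero_add, add_comm] using (GLs.modusPonens C D).derivableUnder)
      linarith
  have hR : ∀ F ∈ Δ, evalWith g β F ≤ x (.right, F) := by
    intro F hF
    have hFT := hΔ F hF
    match F with
    | .var i =>
      change g i ≤ _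
      dsimp only [g]
      rw [if_pos hFT]
      exact max_le (hrel _ hbot _ hFT (GLs.bot _)) (hrel _ hFT _ hFT (GLs.id _))
    | .bot => exact hrel _ hFT _ hFT (GLs.id _)
    | .imp C D => exact absurd hF (hatom C D)
  calc (Γ.map fun F => x (.left, F)).sum ≤ (Γ.map (evalWith g β)).sum :=
        Multiset.sum_map_le_sum_map _ _ hL
    _ ≤ (Δ.map (evalWith g β)).sum := hvalid.evalWith_le hβ hg
    _ ≤ (Δ.map fun F => x (.right, F)).sum := Multiset.sum_map_le_sum_map _ _ hR

theorem exists_subformula_closed (Γ : Multiset Formula) :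
    ∃ T : Finset Formula, (∀ F ∈ Γ, F ∈ T) ∧
      ∀ C D, Formula.imp C D ∈ T → C ∈ T ∧ D ∈ T := by
  classical
  have hone : ∀ F : Formula, ∃ T : Finset Formula, F ∈ T ∧
      ∀ C D, Formula.imp C D ∈ T → C ∈ T ∧ D ∈ T := by
    intro F
    induction F with
    | var i => exact ⟨{.var i}, by simp, by simp⟩
    | bot => exact ⟨{.bot}, by simp, by simp⟩
    | imp A B ihA ihB =>
      obtain ⟨S, hA, hS⟩ := ihA
      obtain ⟨T, hB, hT⟩ := ihB
      refine ⟨insert (A.imp B) (S ∪ T), by simp, fun C D h => ?_⟩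
      simp only [Finset.mem_insert, Finset.mem_union, Formula.imp.injEq] at h ⊢
      rcases h with ⟨rfl, rfl⟩ | h | h
      · exact ⟨Or.inr (Or.inl hA), Or.inr (Or.inr hB)⟩
      · exact ⟨Or.inr (Or.inl (hS C D h).1), Or.inr (Or.inl (hS C D h).2)⟩
      · exact ⟨Or.inr (Or.inr (hT C D h).1), Or.inr (Or.inr (hT C D h).2)⟩
  induction Γ using Multiset.induction_on with
  | empty => exact ⟨∅, by simp, by simp⟩
  | cons F Γ ih =>
    obtain ⟨S, hF, hS⟩ := hone F
    obtain ⟨T, hΓ, hT⟩ := ih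
    refine ⟨S ∪ T, fun G hG => ?_, fun C D h => ?_⟩
    · rcases Multiset.mem_cons.1 hG with rfl | hG
      exacts [Finset.mem_union_left _ hF, Finset.mem_union_right _ (hΓ G hG)]
    · rcases Finset.mem_union.1 h with h | h
      · exact ⟨Finset.mem_union_left _ (hS C D h).1, Finset.mem_union_left _ (hS C D h).2⟩
      · exact ⟨Finset.mem_union_right _ (hT C D h).1, Finset.mem_union_right _ (hT C D h).2⟩

theorem Decided.mono {H H' : Multiset Formula} (hH : H ⊆ H') {F : Formula} (h : Decided H F) :
    Decided H' F := by
  match F with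
  | .var _ => trivial
  | .bot => trivial
  | .imp _ _ => exact Or.imp (fun h => hH h) (fun h => hH h) h

/-- Each split lowers the number of undecided formulas in `T`. The added `D ⇒ C` may lie outside
`T`, but its components do not. -/
theorem derivableUnder_of_valid {Γ Δ : Multiset Formula} (T : Finset Formula)
    (hbot : Formula.bot ∈ T) (hΓ : ∀ F ∈ Γ, F ∈ T) (hΔ : ∀ F ∈ Δ, F ∈ T)
    (hclosed : ∀ C D, Formula.imp C D ∈ T → C ∈ T ∧ D ∈ T)
    (hatom : ∀ A B, Formula.imp A B ∉ Δ) (hvalid : Sequent.Valid ⟨Γ, Δ⟩)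
    (H : Multiset Formula) (hT : ∀ X, IsComponent (Γ + H) X → X ∈ T) :
    DerivableUnder H Γ Δ := by
  classical
  induction hm : (T.filter fun F => ¬ Decided H F).card using Nat.strong_induction_on
    generalizing H with
  | _ m ih =>
    by_cases hdec : ∀ X, IsComponent (Γ + H) X → Decided H X
    · exact derivableUnder_of_decided T hbot hΓ hΔ hT hdec hatom hvalid
    push Not at hdec
    obtain ⟨X, hX, hnot⟩ := hdec
    match X with
    | .var _ => exact absurd trivial hnot
    | .bot => exact absurd trivial hnot
    | .imp C D =>
      have hXT := hT _ hX
      have step : ∀ h : Formula, (h = C.imp D ∨ h = D.imp C) →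
          DerivableUnder (H + {h}) Γ Δ := by
        intro h hh
        refine ih _ ?_ (H + {h}) ?_ rfl
        · rw [← hm]
          refine Finset.card_lt_card (Finset.ssubset_iff_of_subset ?_ |>.2
            ⟨C.imp D, Finset.mem_filter.2 ⟨hXT, hnot⟩, fun hmem => ?_⟩)
          · intro F hF
            rw [Finset.mem_filter] at hF ⊢
            exact ⟨hF.1, fun hd => hF.2
              (hd.mono (Multiset.subset_of_le (Multiset.le_add_right _ _)))⟩
          · refine (Finset.mem_filter.1 hmem).2 ?_
            rcases hh with rfl | rfl
            · exact Or.inl (by simp)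
            · exact Or.inr (by simp)
        · rintro Y ⟨Z, hZ⟩
          have hYC := hclosed C D hXT
          rw [← add_assoc, Multiset.mem_add, Multiset.mem_add (a := Z.imp Y),
            Multiset.mem_singleton, Multiset.mem_singleton] at hZ
          rcases hZ with (h₁ | h₁) | (h₁ | h₁)
          · exact hT Y ⟨Z, Or.inl h₁⟩
          · rcases hh with rfl | rfl <;> cases h₁
            exacts [hYC.1, hYC.2]
          · exact hT Y ⟨Z, Or.inr h₁⟩
          · rcases hh with rfl | rfl <;> cases h₁
            exacts [hYC.2, hYC.1]
      exact DerivableUnder.split hX (step _ (Or.inl rfl)) (step _ (Or.inr rfl))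

theorem GLs.of_valid_of_atomic {Γ Δ : Multiset Formula} (hatom : ∀ A B, Formula.imp A B ∉ Δ)
    (hvalid : Sequent.Valid ⟨Γ, Δ⟩) : GLs ⟨Γ, Δ⟩ := by
  obtain ⟨T, hmem, hclosed⟩ := exists_subformula_closed ({Formula.bot} + Γ + Δ)
  have hΓ : ∀ F ∈ Γ, F ∈ T := fun F hF => hmem F (by simp [hF])
  obtain ⟨N, hN⟩ := derivableUnder_of_valid T (hmem _ (by simp)) hΓ
    (fun F hF => hmem F (by simp [hF])) hclosed hatom hvalid 0 (by
      rintro X ⟨Y, hY⟩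
      rw [add_zero] at hY
      exact hY.elim (fun h => (hclosed _ _ (hΓ _ h)).1) (fun h => (hclosed _ _ (hΓ _ h)).2))
  simpa using hN

/-- The number of connectives of a formula. -/
def Formula.size : Formula → ℕ
  | .var _ => 0
  | .bot => 0
  | .imp A B => A.size + B.size + 1

theorem Sequent.Valid.of_impR {Γ Δ : Multiset Formula} {A B : Formula}
    (h : Sequent.Valid ⟨Γ, Δ + {A.imp B}⟩) :
    Sequent.Valid ⟨Γ, Δ⟩ ∧ Sequent.Valid ⟨Γ + {A}, Δ + {B}⟩ := by
  refine ⟨fun v => ?_, fun v => ?_⟩ <;>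
  · have hv := h v
    simp only [Multiset.map_add, Multiset.sum_add, Multiset.map_singleton,
      Multiset.sum_singleton, v.map_imp, Carrier.coe_imp] at *
    have h₁ := min_le_left 0 ((v.val B : ℝ) - v.val A)
    have h₂ := min_le_right 0 ((v.val B : ℝ) - v.val A)
    linarith

/-- Read backwards, (⇒,r) preserves validity and lowers the number of connectives on the right,
whatever it moves to the left. -/
theorem GLs.of_valid {Γ Δ : Multiset Formula} (hvalid : Sequent.Valid ⟨Γ, Δ⟩) :
    GLs ⟨Γ, Δ⟩ := by
  induction hm : (Δ.map Formula.size).sum using Nat.strong_induction_on generalizing Γ Δ with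
  | _ m ih =>
    by_cases hatom : ∀ A B, Formula.imp A B ∉ Δ
    · exact GLs.of_valid_of_atomic hatom hvalid
    push Not at hatom
    obtain ⟨A, B, hAB⟩ := hatom
    obtain ⟨Θ, rfl⟩ := Multiset.exists_cons_of_mem hAB
    rw [← Multiset.singleton_add, add_comm] at hvalid hm ⊢
    simp only [Multiset.map_add, Multiset.sum_add, Multiset.map_singleton,
      Multiset.sum_singleton, Formula.size] at hm
    refine GLs.impR _ _ _ _ (ih _ ?_ hvalid.of_impR.1 rfl) (ih _ ?_ hvalid.of_impR.2 rfl)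
    · omega
    · simp only [Multiset.map_add, Multiset.sum_add, Multiset.map_singleton,
        Multiset.sum_singleton]
      omega

end Completeness

end Lukasiewicz

theorem mainTheorem12 (S : Lukasiewicz.Sequent) :
    Lukasiewicz.GLs S ↔ S.Valid :=
  ⟨Lukasiewicz.GLs.valid, Lukasiewicz.GLs.of_valid⟩
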